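/- Let $J=(a_0,+\infty)$ with $a_0\in\mathbb R\cup\{-\infty\}$, let $h\colon J\to(0,+\infty)$ be a growth rate, i.e. a strictly increasing homeomorphism, and let $A\colon J\to M_n(\mathbb R)$ be continuous. Fix any norm $|\cdot|$ on $\mathbb R^n$ and let $\|\cdot\|$ be the induced matrix norm. Consider the linear system $$x'=A(t)x,\qquad t\in J, \tag{1}$$ with transition matrix $\Phi(t,s)$. For $t,s\in J$ put $t*s:=h^{-1}(h(t)h(s))$, $e_*:=h^{-1}(1)$, $t^{*-1}:=h^{-1}(1/h(t))$, and $|t|_*:=t$ if $t\ge e_*$, $|t|_*:=t^{*-1}$ if $t<e_*$. For an interval $\mathcal I\subseteq J$, the system (1) - has a *uniform $h$-dichotomy* on $\mathcal I$ if there are projections $P(t)$, $t\in\mathcal I$, and constants $K\ge1$, $\alpha>0$ such that $P(t)\Phi(t,s)=\Phi(t,s)P(s)$ for all $t,s\in\mathcal I$, $\|\Phi(t,s)P(s)\|\le K\left(\frac{h(t)}{h(s)}\right)^{-\alpha}$ for all $t\ge s$ in $\mathcal I$, and $\|\Phi(t,s)(I-P(s))\|\le K\left(\frac{h(s)}{h(t)}\right)^{-\alpha}$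 for all $t\le s$ in $\mathcal I$; - has *uniform bounded $h$-growth* (respectively *uniform bounded $h$-decay*) on $\mathcal I$ if for each $T>e_*$ there is $C_T\ge1$ such that every solution $x$ of (1) satisfies $|x(t)|\le C_T|x(s)|$ for all $s\in\mathcal I$ and all $t\in[s,s*T]\cap\mathcal I$ (respectively all $t\in[s*T^{*-1},s]\cap\mathcal I$); - is *uniformly $h$-noncritical* on $\mathcal I$ if there are $T>e_*$ and $\theta\in(0,1)$ such that every solution $x$ of (1) satisfies $|x(t)|\le\theta\sup\{|x(u)|\colon |u*t^{*-1}|_*\le T\}$ for all $t$ with $[t*T^{*-1},t*T]\subseteq\mathcal I$; - is *$h$-expansive* on $\mathcal I$ if there are $L,\beta>0$ such that, for every solution $x$ of (1), every $[a,b]\subseteq\mathcal I$ and every $t\in[a,b]$, $$|x(t)|\le L\left\{h(t*a^{*-1})^{-\beta}|x(a)|+h(b*t^{*-1})^{-\beta}|x(b)|\right\}.$$ **Theorem.** Suppose that (1) has uniform bounded $h$-growth on $[e_*,+\infty)$ and uniform bounded $h$-decay on $(a_0,e_*]$. Then the following three statements are equivalent: - (i) the system (1) has uniform $h$-dichotomies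 on $[e_*,+\infty)$ and on $(a_0,e_*]$, and it has no nontrivial solution that is bounded on $J$; - (ii) the system (1) is $h$-expansive on $J$; - (iii) the system (1) is uniformly $h$-noncritical on $J$. Moreover, without the assumptions of uniform bounded $h$-growth and uniform bounded $h$-decay, the implications (i) $\Rightarrow$ (ii) $\Rightarrow$ (iii) still hold. -/

import Mathlib

open Set

noncomputable section

namespace HDichotomy

/-- The open interval `J = (a₀, +∞)` of the real line, with `a₀ ∈ ℝ ∪ {-∞}` (`⊥` is `-∞`). It carries
the order and the topology induced from `ℝ`. -/
abbrev J (a₀ : WithBot ℝ) : Type := {t : ℝ // a₀ < (t : WithBot ℝ)}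

/-- A growth rate on `J`: a strictly increasing homeomorphism `h : J → (0, +∞)`. -/
structure GrowthRate (a₀ : WithBot ℝ) where
  toHomeomorph : J a₀ ≃ₜ Ioi (0 : ℝ)
  strictMono_toHomeomorph : StrictMono toHomeomorph

namespace GrowthRate

variable {a₀ : WithBot ℝ}

/-- A growth rate, read as a real-valued function on `J`. -/
instance : CoeFun (GrowthRate a₀) (fun _ => J a₀ → ℝ) := ⟨fun h t => (h.toHomeomorph t : ℝ)⟩

theorem pos (h : GrowthRate a₀) (t : J a₀) : 0 < h t := (h.toHomeomorph t).2

/-- The inverse function `h⁻¹ : (0, +∞) → J`. -/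
def inv (h : GrowthRate a₀) (y : ℝ) (hy : 0 < y) : J a₀ := h.toHomeomorph.symm ⟨y, hy⟩

/-- The group operation `t ∗ s = h⁻¹ (h(t) h(s))` on `J`. -/
def star (h : GrowthRate a₀) (t s : J a₀) : J a₀ := h.inv (h t * h s) (mul_pos (h.pos t) (h.pos s))

/-- The unit `e∗ = h⁻¹(1)` of the group `(J, ∗)`. -/
def unit (h : GrowthRate a₀) : J a₀ := h.inv 1 one_pos

/-- The inverse `t^{∗-1} = h⁻¹(1 / h(t))` of `t` in the group `(J, ∗)`. -/
def starInv (h : GrowthRate a₀) (t : J a₀) : J a₀ := h.inv (1 / h t) (one_div_pos.mpr (h.pos t))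

/-- The absolute value `|t|∗` of the ordered group `(J, ∗)`. -/
def starAbs (h : GrowthRate a₀) (t : J a₀) : J a₀ :=
  if h.unit ≤ t then t else h.starInv t

end GrowthRate

section System

variable {a₀ : WithBot ℝ} {E : Type*} [NormedAddCommGroup E] [NormedSpace ℝ E]

/-- `x` is a solution on `J` of the linear system `x' = A(t) x`. Only the values of `x` on the open
interval `J` matter. -/
def IsSolution (A : J a₀ → E →L[ℝ] E) (x : ℝ → E) : Prop :=
  ∀ t : J a₀, HasDerivAt x (A t (x t)) (t : ℝ)

/-- `Φ` is the transition matrix `(t, s) ↦ Φ(t, s)` of the system `x' = A(t) x`: for each `s` in `J` the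
function `t ↦ Φ(t, s)` solves the matrix initial value problem `X' = A(t) X`, `X(s) = I` on `J`. -/
def IsTransitionMatrix (A : J a₀ → E →L[ℝ] E) (Φ : ℝ → ℝ → E →L[ℝ] E) : Prop :=
  ∀ s : J a₀, Φ s s = ContinuousLinearMap.id ℝ E ∧
    ∀ t : J a₀, HasDerivAt (fun r : ℝ => Φ r s) ((A t).comp (Φ t s)) (t : ℝ)

/-- Uniform `h`-dichotomy of `x' = A(t) x` on `I`; here `Q(t) = I - P(t)`. -/
def UniformDichotomyOn (h : GrowthRate a₀) (A : J a₀ → E →L[ℝ] E) (I : Set (J a₀)) : Prop :=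
  ∃ Φ : ℝ → ℝ → E →L[ℝ] E, IsTransitionMatrix A Φ ∧
    ∃ (P : J a₀ → E →L[ℝ] E) (K α : ℝ), 1 ≤ K ∧ 0 < α ∧
      (∀ t ∈ I, (P t).comp (P t) = P t) ∧
      (∀ t ∈ I, ∀ s ∈ I, (P t).comp (Φ t s) = (Φ t s).comp (P s)) ∧
      (∀ t ∈ I, ∀ s ∈ I, s ≤ t → ‖(Φ t s).comp (P s)‖ ≤ K * (h t / h s) ^ (-α)) ∧
      (∀ t ∈ I, ∀ s ∈ I, t ≤ s →
        ‖(Φ t s).comp (ContinuousLinearMap.id ℝ E - P s)‖ ≤ K * (h s / h t) ^ (-α))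

/-- Uniform bounded `h`-growth of `x' = A(t) x` on `I`. -/
def UniformBoundedGrowthOn (h : GrowthRate a₀) (A : J a₀ → E →L[ℝ] E) (I : Set (J a₀)) : Prop :=
  ∀ T : J a₀, h.unit < T → ∃ C : ℝ, 1 ≤ C ∧ ∀ x : ℝ → E, IsSolution A x →
    ∀ s ∈ I, ∀ t ∈ Icc s (h.star s T) ∩ I, ‖x t‖ ≤ C * ‖x s‖

/-- Uniform bounded `h`-decay of `x' = A(t) x` on `I`. -/
def UniformBoundedDecayOn (h : GrowthRate a₀) (A : J a₀ → E →L[ℝ] E) (I : Set (J a₀)) : Prop :=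
  ∀ T : J a₀, h.unit < T → ∃ C : ℝ, 1 ≤ C ∧ ∀ x : ℝ → E, IsSolution A x →
    ∀ s ∈ I, ∀ t ∈ Icc (h.star s (h.starInv T)) s ∩ I, ‖x t‖ ≤ C * ‖x s‖

/-- Uniform `h`-noncriticality of `x' = A(t) x` on `I`. The supremum is that of a continuous function
over a nonempty compact set. -/
def UniformNoncriticalOn (h : GrowthRate a₀) (A : J a₀ → E →L[ℝ] E) (I : Set (J a₀)) : Prop :=
  ∃ T : J a₀, h.unit < T ∧ ∃ θ ∈ Ioo (0 : ℝ) 1, ∀ x : ℝ → E, IsSolution A x →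
    ∀ t : J a₀, Icc (h.star t (h.starInv T)) (h.star t T) ⊆ I →
      ‖x t‖ ≤ θ * sSup {r : ℝ | ∃ u : J a₀, h.starAbs (h.star u (h.starInv t)) ≤ T ∧ r = ‖x u‖}

/-- `h`-expansiveness of `x' = A(t) x` on `I`. -/
def ExpansiveOn (h : GrowthRate a₀) (A : J a₀ → E →L[ℝ] E) (I : Set (J a₀)) : Prop :=
  ∃ L β : ℝ, 0 < L ∧ 0 < β ∧ ∀ x : ℝ → E, IsSolution A x →
    ∀ a b : J a₀, Icc a b ⊆ I → ∀ t ∈ Icc a b,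
      ‖x t‖ ≤ L * (h (h.star t (h.starInv a)) ^ (-β) * ‖x a‖
        + h (h.star b (h.starInv t)) ^ (-β) * ‖x b‖)

/-- Every solution of `x' = A(t) x` that is bounded on `J` vanishes on `J`. -/
def NoNontrivialBoundedSolution (A : J a₀ → E →L[ℝ] E) : Prop :=
  ∀ x : ℝ → E, IsSolution A x → (∃ M : ℝ, ∀ t : J a₀, ‖x t‖ ≤ M) → ∀ t : J a₀, x t = 0

/-- Uniform `h`-dichotomies on both half-lines `[e∗, +∞)` and `(a₀, e∗]`, and no nontrivial bounded
solution. -/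
def HalfLineDichotomies (h : GrowthRate a₀) (A : J a₀ → E →L[ℝ] E) : Prop :=
  UniformDichotomyOn h A (Ici h.unit) ∧ UniformDichotomyOn h A (Iic h.unit) ∧
    NoNontrivialBoundedSolution A

end System

end HDichotomy

end

/-! The substitution `τ = log h(t)` turns the group `(J, ∗)` into `(ℝ, +)` and powers of `h` into
exponentials. The statement thus becomes one about exponential dichotomies of an invertible
evolution family `U` on `ℝ` that is merely continuous in time.

(i) ⇒ (ii): inside one half-line, split a trajectory into its stable part, estimated from the left
end, and its unstable part, estimated from the right end. To cross `0`, note that a vector in `ker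
Q(0) ∩ ker (I - P(0))` has a bounded trajectory, hence vanishes. In finite dimension `‖v‖` is
therefore controlled by `‖Q(0) v‖`, estimated from the past, plus `‖v - P(0) v‖`, estimated from the
future (`expansive_of_halfLine_dichotomies`).

(ii) ⇒ (iii): apply expansiveness on a window centred at `t` and long enough for the exponential
weights to beat `L`.

(iii) ⇒ (i): iterating the noncritical inequality forces a bounded solution below `θ ^ n * M` for
all `n`, so it is zero. On `[0, ∞)`, let `V` be the space of initial values with bounded
trajectories and `W` any complement. Trajectories from `V` decay by the same iteration. Trajectories
from `W` outgrow their initial value by a time that compactness makes uniform; from then on their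
running maximum gains a factor `1/θ` per time `T`, and bounded growth passes this gain to the norm
itself. Bounded growth also keeps the two families of trajectories uniformly apart, so the
transported projections are bounded (`IsNoncritical.exists_isExpDichotomy`). The other half-line
follows by reversing time, which exchanges decay and growth. -/

noncomputable section
namespace HDichotomy

/-! ### Existence and uniqueness for linear equations with continuous coefficients. -/

section LinearODE

open MeasureTheory Topology

variable {E : Type*} [NormedAddCommGroup E] [NormedSpace ℝ E]

/-- The terms of the Peano–Baker series of `X' = B(t) X`, `X(s) = I`. -/
def peanoBakerTerm (B : ℝ → E →L[ℝ] E) (s : ℝ) : ℕ → ℝ → E →L[ℝ] E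
  | 0, _ => ContinuousLinearMap.id ℝ E
  | n + 1, t => ∫ r in s..t, (B r).comp (peanoBakerTerm B s n r)

theorem hasDerivAt_integral_of_isOpen {F : Type*} [NormedAddCommGroup F] [NormedSpace ℝ F]
    [CompleteSpace F] {S : Set ℝ} (hS : IsOpen S) (hS' : S.OrdConnected) {f : ℝ → F}
    (hf : ContinuousOn f S) {s t : ℝ} (hs : s ∈ S) (ht : t ∈ S) :
    HasDerivAt (fun u => ∫ r in s..u, f r) (f t) t :=
  intervalIntegral.integral_hasDerivAt_right
    ((hf.mono (hS'.uIcc_subset hs ht)).intervalIntegrable)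
    (hf.stronglyMeasurableAtFilter hS t ht) (hf.continuousAt (hS.mem_nhds ht))

theorem continuousOn_peanoBakerTerm [CompleteSpace E] {S : Set ℝ} (hS : IsOpen S)
    (hS' : S.OrdConnected) {B : ℝ → E →L[ℝ] E} (hB : ContinuousOn B S) {s : ℝ} (hs : s ∈ S) (n : ℕ) :
    ContinuousOn (peanoBakerTerm B s n) S := by
  induction n with
  | zero => exact continuousOn_const
  | succ n ih =>
    intro t ht
    exact (hasDerivAt_integral_of_isOpen hS hS' (hB.clm_comp ih) hs ht).continuousAt.continuousWithinAt

theorem hasDerivAt_peanoBakerTerm_succ [CompleteSpace E] {S : Set ℝ} (hS : IsOpen S)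
    (hS' : S.OrdConnected) {B : ℝ → E →L[ℝ] E} (hB : ContinuousOn B S) {s t : ℝ} (hs : s ∈ S)
    (ht : t ∈ S) (n : ℕ) :
    HasDerivAt (peanoBakerTerm B s (n + 1)) ((B t).comp (peanoBakerTerm B s n t)) t :=
  hasDerivAt_integral_of_isOpen hS hS'
    (hB.clm_comp (continuousOn_peanoBakerTerm hS hS' hB hs n)) hs ht

/-- Each iterated integral raises the power of `|r - s|` by one and contributes the factor `M / (n +
1)`. The unordered interval covers both sides of `s`. -/
theorem norm_peanoBakerTerm_le {B : ℝ → E →L[ℝ] E} {s c d M : ℝ}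
    (hM : ∀ r ∈ Icc c d, ‖B r‖ ≤ M) (hs : s ∈ Icc c d) (n : ℕ) {t : ℝ} (ht : t ∈ Icc c d) :
    ‖peanoBakerTerm B s n t‖ ≤ M ^ n * |t - s| ^ n / n.factorial := by
  have hM0 : 0 ≤ M := (norm_nonneg _).trans (hM s hs)
  induction n generalizing t with
  | zero => simpa [peanoBakerTerm] using ContinuousLinearMap.norm_id_le
  | succ n ih =>
    have hsub : ∀ r ∈ uIoc s t, r ∈ Icc c d := fun r hr =>
      ordConnected_Icc.uIcc_subset hs ht (uIoc_subset_uIcc hr)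
    have h1 : ‖peanoBakerTerm B s (n + 1) t‖
        ≤ ∫ r in uIoc s t, M ^ (n + 1) * |r - s| ^ n / n.factorial := by
      rw [peanoBakerTerm, intervalIntegral.norm_intervalIntegral_eq]
      refine norm_integral_le_of_norm_le (Continuous.integrableOn_uIoc (by fun_prop)) ?_
      refine (ae_restrict_mem measurableSet_uIoc).mono fun r hr => ?_
      calc ‖(B r).comp (peanoBakerTerm B s n r)‖ ≤ ‖B r‖ * ‖peanoBakerTerm B s n r‖ :=
            ContinuousLinearMap.opNorm_comp_le _ _
        _ ≤ M * (M ^ n * |r - s| ^ n / n.factorial) :=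
            mul_le_mul (hM r (hsub r hr)) (ih (hsub r hr)) (norm_nonneg _) hM0
        _ = M ^ (n + 1) * |r - s| ^ n / n.factorial := by ring
    refine h1.trans_eq ?_
    rw [integral_div, integral_const_mul, integral_pow_abs_sub_uIoc, Nat.factorial_succ]
    push_cast
    field_simp

/-- The sum of the Peano–Baker series. -/
def peanoBaker (B : ℝ → E →L[ℝ] E) (s t : ℝ) : E →L[ℝ] E := ∑' n, peanoBakerTerm B s n t

theorem peanoBaker_self (B : ℝ → E →L[ℝ] E) (s : ℝ) :
    peanoBaker B s s = ContinuousLinearMap.id ℝ E := by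
  rw [peanoBaker, tsum_eq_single 0]
  · rfl
  · intro n hn
    obtain ⟨m, rfl⟩ := Nat.exists_eq_succ_of_ne_zero hn
    simp [peanoBakerTerm]

/-- The coefficient need not be bounded on `S`; this localizes to a compact interval, where it is.
-/
theorem exists_Ioo_Icc_subset {S : Set ℝ} (hS : IsOpen S) (hS' : S.OrdConnected) {s t : ℝ}
    (hs : s ∈ S) (ht : t ∈ S) : ∃ c d, s ∈ Ioo c d ∧ t ∈ Ioo c d ∧ Icc c d ⊆ S := by
  wlog hst : s ≤ t generalizing s t
  · obtain ⟨c, d, h1, h2, h3⟩ := this ht hs (le_of_not_ge hst)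
    exact ⟨c, d, h2, h1, h3⟩
  obtain ⟨ε, hε, hε'⟩ := Metric.isOpen_iff.1 hS s hs
  obtain ⟨δ, hδ, hδ'⟩ := Metric.isOpen_iff.1 hS t ht
  refine ⟨s - ε / 2, t + δ / 2, ⟨by linarith, by linarith⟩, ⟨by linarith, by linarith⟩,
    hS'.out (hε' ?_) (hδ' ?_)⟩
  · rw [Metric.mem_ball, Real.dist_eq, abs_lt]; constructor <;> linarith
  · rw [Metric.mem_ball, Real.dist_eq, abs_lt]; constructor <;> linarith

theorem exists_norm_le_Icc {B : ℝ → E →L[ℝ] E} {S : Set ℝ} (hB : ContinuousOn B S) {c d : ℝ}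
    (hcd : Icc c d ⊆ S) : ∃ M, ∀ r ∈ Icc c d, ‖B r‖ ≤ M :=
  isCompact_Icc.exists_bound_of_continuousOn (hB.mono hcd)

/-- Termwise differentiation: on a compact interval around `s` and `t` the differentiated series is
dominated by `M` times an exponential series. -/
theorem hasDerivAt_peanoBaker [CompleteSpace E] {S : Set ℝ} (hS : IsOpen S)
    (hS' : S.OrdConnected) {B : ℝ → E →L[ℝ] E} (hB : ContinuousOn B S) {s t : ℝ} (hs : s ∈ S)
    (ht : t ∈ S) :
    HasDerivAt (peanoBaker B s) ((B t).comp (peanoBaker B s t)) t := by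
  obtain ⟨c, d, hsc, htc, hcd⟩ := exists_Ioo_Icc_subset hS hS' hs ht
  obtain ⟨M, hM⟩ := exists_norm_le_Icc hB hcd
  have hsc' := Ioo_subset_Icc_self hsc
  have hM0 : 0 ≤ M := (norm_nonneg _).trans (hM s hsc')
  have hbound : ∀ (n : ℕ), ∀ r ∈ Ioo c d,
      ‖peanoBakerTerm B s n r‖ ≤ (M * (d - c)) ^ n / n.factorial := by
    intro n r hr
    refine (norm_peanoBakerTerm_le hM hsc' n (Ioo_subset_Icc_self hr)).trans ?_
    rw [mul_pow]
    gcongr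
    rw [abs_le]
    constructor <;> linarith [hr.1, hr.2, hsc.1, hsc.2]
  have hsum : Summable fun n : ℕ => (M * (d - c)) ^ n / n.factorial :=
    Real.summable_pow_div_factorial _
  have hterm : ∀ r ∈ Ioo c d, Summable fun n => peanoBakerTerm B s n r := fun r hr =>
    Summable.of_norm_bounded hsum fun n => hbound n r hr
  have hsplit : ∀ r ∈ Ioo c d, peanoBaker B s r
      = ContinuousLinearMap.id ℝ E + ∑' n, peanoBakerTerm B s (n + 1) r := fun r hr =>
    (hterm r hr).tsum_eq_zero_add
  have hmain : HasDerivAt (fun r => ∑' n, peanoBakerTerm B s (n + 1) r)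
      (∑' n, (B t).comp (peanoBakerTerm B s n t)) t := by
    refine hasDerivAt_tsum_of_isPreconnected (u := fun n : ℕ => M * ((M * (d - c)) ^ n / n.factorial))
      (g' := fun n r => (B r).comp (peanoBakerTerm B s n r)) (hsum.mul_left M)
      isOpen_Ioo isPreconnected_Ioo
      (fun n r hr => hasDerivAt_peanoBakerTerm_succ hS hS' hB hs (hcd (Ioo_subset_Icc_self hr)) n)
      (fun n r hr => ?_) htc ((summable_nat_add_iff 1).2 (hterm t htc)) htc
    exact (ContinuousLinearMap.opNorm_comp_le _ _).trans
      (mul_le_mul (hM r (Ioo_subset_Icc_self hr)) (hbound n r hr) (norm_nonneg _) hM0)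
  have hcomp : ∑' n, (B t).comp (peanoBakerTerm B s n t) = (B t).comp (peanoBaker B s t) :=
    (((ContinuousLinearMap.compL ℝ E E E) (B t)).map_tsum (hterm t htc)).symm
  rw [hcomp] at hmain
  refine (hmain.const_add (ContinuousLinearMap.id ℝ E)).congr_of_eventuallyEq ?_
  filter_upwards [isOpen_Ioo.mem_nhds htc] with r hr using hsplit r hr

theorem eqOn_of_linearODE {S : Set ℝ} (hS : IsOpen S) (hS' : S.OrdConnected) {B : ℝ → E →L[ℝ] E}
    (hB : ContinuousOn B S) {x y : ℝ → E} (hx : ∀ t ∈ S, HasDerivAt x (B t (x t)) t)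
    (hy : ∀ t ∈ S, HasDerivAt y (B t (y t)) t) {s : ℝ} (hs : s ∈ S) (hxy : x s = y s) :
    EqOn x y S := by
  intro t ht
  obtain ⟨c, d, hsc, htc, hcd⟩ := exists_Ioo_Icc_subset hS hS' hs ht
  obtain ⟨M, hM⟩ := exists_norm_le_Icc hB hcd
  refine ODE_solution_unique_of_mem_Ioo (v := fun t z => B t z) (K := M.toNNReal)
    (s := fun _ => univ) (fun r hr => ?_) hsc
    (fun r hr => ⟨hx r (hcd (Ioo_subset_Icc_self hr)), mem_univ _⟩)
    (fun r hr => ⟨hy r (hcd (Ioo_subset_Icc_self hr)), mem_univ _⟩) hxy htc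
  refine ((B r).lipschitz.weaken ?_).lipschitzOnWith
  rw [← norm_toNNReal]
  exact Real.toNNReal_le_toNNReal (hM r (Ioo_subset_Icc_self hr))

end LinearODE

/-! ### The transition matrix of the system on `J`. -/

section Transition

variable {a₀ : WithBot ℝ} {E : Type*} [NormedAddCommGroup E] [NormedSpace ℝ E]

theorem isOpen_setOf_bot_lt (a₀ : WithBot ℝ) : IsOpen {r : ℝ | a₀ < (r : WithBot ℝ)} := by
  induction a₀ with
  | bot => simp
  | coe a =>
    simp only [WithBot.coe_lt_coe]
    exact isOpen_Ioi

theorem ordConnected_setOf_bot_lt (a₀ : WithBot ℝ) :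
    {r : ℝ | a₀ < (r : WithBot ℝ)}.OrdConnected :=
  ⟨fun _ hx _ _ _ hz => lt_of_lt_of_le hx (WithBot.coe_le_coe.2 hz.1)⟩

/-- The extension by zero of the coefficient `A` to the real line. -/
def extendCoeff (A : J a₀ → E →L[ℝ] E) : ℝ → E →L[ℝ] E :=
  Function.extend Subtype.val A 0

theorem extendCoeff_coe (A : J a₀ → E →L[ℝ] E) (t : J a₀) : extendCoeff A t = A t :=
  Subtype.val_injective.extend_apply _ _ _

theorem continuousOn_extendCoeff {A : J a₀ → E →L[ℝ] E} (hA : Continuous A) :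
    ContinuousOn (extendCoeff A) {r : ℝ | a₀ < (r : WithBot ℝ)} := by
  rw [continuousOn_iff_continuous_domRestrict]
  exact hA.congr fun t => (extendCoeff_coe A t).symm

theorem exists_isTransitionMatrix [CompleteSpace E] {A : J a₀ → E →L[ℝ] E} (hA : Continuous A) :
    ∃ Φ, IsTransitionMatrix A Φ := by
  refine ⟨fun t s => peanoBaker (extendCoeff A) s t, fun s => ⟨peanoBaker_self _ _, fun t => ?_⟩⟩
  have := hasDerivAt_peanoBaker (isOpen_setOf_bot_lt a₀) (ordConnected_setOf_bot_lt a₀)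
    (continuousOn_extendCoeff hA) s.2 t.2
  rwa [extendCoeff_coe] at this

theorem IsSolution.eq_of_eq {A : J a₀ → E →L[ℝ] E} (hA : Continuous A) {x y : ℝ → E}
    (hx : IsSolution A x) (hy : IsSolution A y) (s : J a₀) (hxy : x s = y s) (t : J a₀) :
    x t = y t := by
  refine eqOn_of_linearODE (isOpen_setOf_bot_lt a₀) (ordConnected_setOf_bot_lt a₀)
    (continuousOn_extendCoeff hA) (fun r hr => ?_) (fun r hr => ?_) s.2 hxy t.2
  · rw [extendCoeff_coe A ⟨r, hr⟩]; exact hx ⟨r, hr⟩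
  · rw [extendCoeff_coe A ⟨r, hr⟩]; exact hy ⟨r, hr⟩

variable {A : J a₀ → E →L[ℝ] E} {Φ : ℝ → ℝ → E →L[ℝ] E}

theorem IsTransitionMatrix.isSolution (hΦ : IsTransitionMatrix A Φ) (s : J a₀) (v : E) :
    IsSolution A fun t => Φ t s v := fun t => by
  simpa using ((hΦ s).2 t).clm_apply (hasDerivAt_const (t : ℝ) v)

theorem IsTransitionMatrix.apply_self (hΦ : IsTransitionMatrix A Φ) (s : J a₀) (v : E) :
    Φ s s v = v := by rw [(hΦ s).1]; rfl

theorem IsTransitionMatrix.apply_solution (hΦ : IsTransitionMatrix A Φ) (hA : Continuous A)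
    {x : ℝ → E} (hx : IsSolution A x) (t s : J a₀) : Φ t s (x s) = x t :=
  (hΦ.isSolution s (x s)).eq_of_eq hA hx s (hΦ.apply_self s _) t

theorem IsTransitionMatrix.comp (hΦ : IsTransitionMatrix A Φ) (hA : Continuous A) (t s r : J a₀) :
    (Φ t s).comp (Φ s r) = Φ t r :=
  ContinuousLinearMap.ext fun v => hΦ.apply_solution hA (hΦ.isSolution r v) t s

/-- Each half-line dichotomy supplies its own transition matrix; this lets both be read through a
single one. -/
theorem IsTransitionMatrix.unique (hΦ : IsTransitionMatrix A Φ) (hA : Continuous A)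
    {Ψ : ℝ → ℝ → E →L[ℝ] E} (hΨ : IsTransitionMatrix A Ψ) (t s : J a₀) : Φ t s = Ψ t s := by
  ext v
  have := hΦ.apply_solution hA (hΨ.isSolution s v) t s
  rwa [hΨ.apply_self] at this

end Transition

/-! ### Evolution families, exponential dichotomies, and expansiveness. -/

section Evolution

open Filter Topology

variable {E : Type*} [NormedAddCommGroup E] [NormedSpace ℝ E]

/-- A continuous, invertible evolution family on the real line. -/
structure IsEvolutionFamily (U : ℝ → ℝ → E →L[ℝ] E) : Prop where
  self : ∀ t, U t t = ContinuousLinearMap.id ℝ E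
  comp : ∀ t s r, (U t s).comp (U s r) = U t r
  continuous_left : ∀ s, Continuous fun t => U t s

/-- The projections `P` define an exponential dichotomy on `I` with constants `K` and `α`. -/
structure IsExpDichotomy (U : ℝ → ℝ → E →L[ℝ] E) (P : ℝ → E →L[ℝ] E) (I : Set ℝ) (K α : ℝ) :
    Prop where
  one_le : 1 ≤ K
  pos : 0 < α
  idem : ∀ t ∈ I, (P t).comp (P t) = P t
  comm : ∀ t ∈ I, ∀ s ∈ I, (P t).comp (U t s) = (U t s).comp (P s)
  stable : ∀ t ∈ I, ∀ s ∈ I, s ≤ t → ‖(U t s).comp (P s)‖ ≤ K * Real.exp (-α * (t - s))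
  unstable : ∀ t ∈ I, ∀ s ∈ I, t ≤ s →
    ‖(U t s).comp (ContinuousLinearMap.id ℝ E - P s)‖ ≤ K * Real.exp (-α * (s - t))

variable {U : ℝ → ℝ → E →L[ℝ] E}

namespace IsEvolutionFamily

theorem apply_self (hU : IsEvolutionFamily U) (t : ℝ) (v : E) : U t t v = v := by
  rw [hU.self]; rfl

theorem apply_apply (hU : IsEvolutionFamily U) (t s r : ℝ) (v : E) : U t s (U s r v) = U t r v := by
  rw [← hU.comp t s r]; rfl

theorem continuous_apply (hU : IsEvolutionFamily U) (s : ℝ) (v : E) :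
    Continuous fun t => U t s v :=
  (hU.continuous_left s).clm_apply continuous_const

theorem reverse (hU : IsEvolutionFamily U) : IsEvolutionFamily fun t s => U (-t) (-s) where
  self t := hU.self (-t)
  comp t s r := hU.comp (-t) (-s) (-r)
  continuous_left s := (hU.continuous_left (-s)).comp continuous_neg

/-- `U t s` is the inverse of `U s t`, and inversion is continuous at units of a Banach algebra. -/
theorem continuous_right [CompleteSpace E] (hU : IsEvolutionFamily U) (t : ℝ) :
    Continuous fun s => U t s := by
  have hunit : ∀ s, ∃ w : (E →L[ℝ] E)ˣ, (w : E →L[ℝ] E) = U s t ∧ ((w⁻¹ : _) : E →L[ℝ] E) = U t s :=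
    fun s => ⟨⟨U s t, U t s, (hU.comp s t s).trans (hU.self s), (hU.comp t s t).trans (hU.self t)⟩,
      rfl, rfl⟩
  have heq : (fun s => U t s) = fun s => Ring.inverse (U s t) := by
    funext s
    obtain ⟨w, hw, hw'⟩ := hunit s
    rw [← hw, ← hw', Ring.inverse_unit]
  rw [heq, continuous_iff_continuousAt]
  intro s
  obtain ⟨w, hw, -⟩ := hunit s
  refine ContinuousAt.comp (f := fun s => U s t) (g := Ring.inverse) ?_
    (hU.continuous_left t).continuousAt
  rw [← hw]
  exact NormedRing.inverse_continuousAt w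

theorem exists_norm_le_Icc [CompleteSpace E] (hU : IsEvolutionFamily U) (a b : ℝ) :
    ∃ N, 1 ≤ N ∧ ∀ t ∈ Icc a b, ∀ s ∈ Icc a b, ‖U t s‖ ≤ N := by
  have hc : Continuous fun p : ℝ × ℝ => (U p.1 0).comp (U 0 p.2) :=
    ((hU.continuous_left 0).comp continuous_fst).clm_comp
      ((hU.continuous_right 0).comp continuous_snd)
  obtain ⟨N, hN⟩ := (isCompact_Icc.prod isCompact_Icc : IsCompact (Icc a b ×ˢ Icc a b))
    |>.exists_bound_of_continuousOn hc.continuousOn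
  refine ⟨max 1 N, le_max_left _ _, fun t ht s hs => le_max_of_le_right ?_⟩
  rw [← hU.comp t 0 s]
  exact hN (t, s) ⟨ht, hs⟩

end IsEvolutionFamily

theorem IsExpDichotomy.weaken {P : ℝ → E →L[ℝ] E} {I : Set ℝ} {K α K' α' : ℝ}
    (hP : IsExpDichotomy U P I K α) (hK : K ≤ K') (hα' : 0 < α') (hα : α' ≤ α) :
    IsExpDichotomy U P I K' α' := by
  have hK0 : 0 ≤ K' := by linarith [hP.one_le]
  have key : ∀ u, 0 ≤ u → K * Real.exp (-α * u) ≤ K' * Real.exp (-α' * u) := by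
    intro u hu
    gcongr
  exact ⟨hP.one_le.trans hK, hα', hP.idem, hP.comm,
    fun t ht s hs hst => (hP.stable t ht s hs hst).trans (key _ (by linarith)),
    fun t ht s hs hst => (hP.unstable t ht s hs hst).trans (key _ (by linarith))⟩

/-- Reversing time exchanges stable and unstable directions, hence the complementary projections. -/
theorem IsExpDichotomy.reverse {P : ℝ → E →L[ℝ] E} {I : Set ℝ} {K α : ℝ}
    (hP : IsExpDichotomy (fun t s => U (-t) (-s)) P I K α) :
    IsExpDichotomy U (fun t => ContinuousLinearMap.id ℝ E - P (-t)) (-I) K α where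
  one_le := hP.one_le
  pos := hP.pos
  idem t ht := by
    have := hP.idem (-t) ht
    ext v
    have hv := DFunLike.congr_fun this v
    simp only [ContinuousLinearMap.comp_apply] at hv
    simp [hv]
  comm t ht s hs := by
    have := hP.comm (-t) ht (-s) hs
    simp only [neg_neg] at this
    rw [ContinuousLinearMap.sub_comp, ContinuousLinearMap.comp_sub, this]
    simp
  stable t ht s hs hst := by
    have := hP.unstable (-t) ht (-s) hs (by linarith)
    simp only [neg_neg] at this
    convert this using 4
    ring
  unstable t ht s hs hst := by
    have := hP.stable (-t) ht (-s) hs (by linarith)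
    simp only [neg_neg] at this
    rw [sub_sub_cancel]
    convert this using 4
    ring

theorem IsExpDichotomy.norm_proj_le {P : ℝ → E →L[ℝ] E} {I : Set ℝ} {K α : ℝ}
    (hP : IsExpDichotomy U P I K α) (hU : IsEvolutionFamily U) (v : E) {a t : ℝ} (ha : a ∈ I)
    (ht : t ∈ I) (hat : a ≤ t) :
    ‖P t (U t 0 v)‖ ≤ K * Real.exp (-α * (t - a)) * ‖U a 0 v‖ := by
  have h1 := DFunLike.congr_fun (hP.comm t ht a ha) (U a 0 v)
  simp only [ContinuousLinearMap.comp_apply, hU.apply_apply] at h1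
  rw [h1]
  exact ((U t a).comp (P a)).le_of_opNorm_le (hP.stable t ht a ha hat) _

theorem IsExpDichotomy.norm_sub_proj_le {P : ℝ → E →L[ℝ] E} {I : Set ℝ} {K α : ℝ}
    (hP : IsExpDichotomy U P I K α) (hU : IsEvolutionFamily U) (v : E) {t b : ℝ} (ht : t ∈ I)
    (hb : b ∈ I) (htb : t ≤ b) :
    ‖U t 0 v - P t (U t 0 v)‖ ≤ K * Real.exp (-α * (b - t)) * ‖U b 0 v‖ := by
  have h1 := DFunLike.congr_fun (hP.comm t ht b hb) (U b 0 v)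
  simp only [ContinuousLinearMap.comp_apply, hU.apply_apply] at h1
  have h2 := ((U t b).comp (ContinuousLinearMap.id ℝ E - P b)).le_of_opNorm_le
    (hP.unstable t ht b hb htb) (U b 0 v)
  rw [h1]
  simpa [hU.apply_apply] using h2

theorem IsExpDichotomy.norm_le {P : ℝ → E →L[ℝ] E} {I : Set ℝ} {K α : ℝ}
    (hP : IsExpDichotomy U P I K α) (hU : IsEvolutionFamily U) (v : E) {a t b : ℝ} (ha : a ∈ I)
    (ht : t ∈ I) (hb : b ∈ I) (hat : a ≤ t) (htb : t ≤ b) :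
    ‖U t 0 v‖ ≤ K * Real.exp (-α * (t - a)) * ‖U a 0 v‖
      + K * Real.exp (-α * (b - t)) * ‖U b 0 v‖ := by
  have h1 := hP.norm_proj_le hU v ha ht hat
  have h2 := hP.norm_sub_proj_le hU v ht hb htb
  have h3 := norm_add_le (P t (U t 0 v)) (U t 0 v - P t (U t 0 v))
  rw [add_sub_cancel] at h3
  linarith

/-- The map `v ↦ (f v, g v)` is injective, and in finite dimension injective linear maps are bounded
below. -/
theorem exists_norm_le_add_of_ker_inf_ker [FiniteDimensional ℝ E] (f g : E →L[ℝ] E)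
    (hfg : ∀ v, f v = 0 → g v = 0 → v = 0) : ∃ C, 0 ≤ C ∧ ∀ v, ‖v‖ ≤ C * (‖f v‖ + ‖g v‖) := by
  have hker : LinearMap.ker ((f.prod g : E →L[ℝ] E × E) : E →ₗ[ℝ] E × E) = ⊥ := by
    refine LinearMap.ker_eq_bot'.2 fun v hv => ?_
    have hv' : (f v, g v) = 0 := hv
    exact hfg v (Prod.ext_iff.1 hv').1 (Prod.ext_iff.1 hv').2
  obtain ⟨C, -, hC⟩ := LinearMap.exists_antilipschitzWith _ hker
  refine ⟨C, C.2, fun v => ?_⟩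
  have h1 := hC.le_mul_dist v 0
  rw [map_zero, dist_zero_right, dist_zero_right] at h1
  refine h1.trans (mul_le_mul_of_nonneg_left ?_ C.2)
  exact max_le_add_of_nonneg (norm_nonneg _) (norm_nonneg _)

/-- Exponential dichotomies on both half-lines without nontrivial bounded trajectories yield
expansiveness on the whole line. -/
theorem expansive_of_halfLine_dichotomies [FiniteDimensional ℝ E] (hU : IsEvolutionFamily U)
    {P Q : ℝ → E →L[ℝ] E} {K α K' α' : ℝ} (hP : IsExpDichotomy U P (Ici 0) K α)
    (hQ : IsExpDichotomy U Q (Iic 0) K' α')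
    (hbdd : ∀ v, (∃ M, ∀ t, ‖U t 0 v‖ ≤ M) → v = 0) :
    ∃ L β : ℝ, 0 < L ∧ 0 < β ∧ ∀ v a t b, a ≤ t → t ≤ b →
      ‖U t 0 v‖ ≤ L * (Real.exp (-β * (t - a)) * ‖U a 0 v‖
        + Real.exp (-β * (b - t)) * ‖U b 0 v‖) := by
  obtain ⟨β, hβ, hβα, hβα'⟩ : ∃ β, 0 < β ∧ β ≤ α ∧ β ≤ α' :=
    ⟨min α α', lt_min hP.pos hQ.pos, min_le_left _ _, min_le_right _ _⟩
  obtain ⟨k, hk, hk'⟩ : ∃ k, K ≤ k ∧ K' ≤ k := ⟨max K K', le_max_left _ _, le_max_right _ _⟩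
  replace hP := hP.weaken hk hβ hβα
  replace hQ := hQ.weaken hk' hβ hβα'
  have hk1 := hP.one_le
  have hexp : ∀ u : ℝ, 0 ≤ u → Real.exp (-β * u) ≤ 1 := fun u hu =>
    Real.exp_le_one_iff.2 (by nlinarith)
  -- A vector killed by both maps is stable towards `+∞` and unstable towards `-∞`, so its
  -- trajectory is bounded on the whole line.
  obtain ⟨C, hC0, hC⟩ := exists_norm_le_add_of_ker_inf_ker (Q 0)
    (ContinuousLinearMap.id ℝ E - P 0) (by
      intro v hv1 hv2
      have hv2' : v - P 0 v = 0 := by simpa using hv2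
      refine hbdd v ⟨k * ‖v‖, fun t => ?_⟩
      rcases le_total 0 t with ht | ht
      · have := ((U t 0).comp (P 0)).le_of_opNorm_le (hP.stable t ht 0 self_mem_Ici ht) v
        rw [ContinuousLinearMap.comp_apply, ← sub_eq_zero.1 hv2'] at this
        refine this.trans ?_
        have := hexp (t - 0) (by linarith)
        gcongr
        nlinarith
      · have := ((U t 0).comp (ContinuousLinearMap.id ℝ E - Q 0)).le_of_opNorm_le
          (hQ.unstable t ht 0 self_mem_Iic ht) v
        simp only [ContinuousLinearMap.comp_apply, sub_apply, hv1,
          ContinuousLinearMap.id_apply, sub_zero] at this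
        refine this.trans ?_
        have := hexp (0 - t) (by linarith)
        gcongr
        nlinarith)
  have hzero : ∀ v a b, a ≤ 0 → 0 ≤ b → ‖U 0 0 v‖ ≤ C * k * (Real.exp (-β * (0 - a)) * ‖U a 0 v‖
      + Real.exp (-β * (b - 0)) * ‖U b 0 v‖) := by
    intro v a b ha hb
    have h1 := hQ.norm_proj_le hU v ha self_mem_Iic ha
    have h2 := hP.norm_sub_proj_le hU v self_mem_Ici hb hb
    have h3 := hC (U 0 0 v)
    rw [sub_apply, ContinuousLinearMap.id_apply] at h3
    nlinarith
  -- `k` is the direct estimate within a half-line; `k * (C * k)` is the price of replacing the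
  -- value at `0` by the values at `a` and `b`.
  refine ⟨k + k * (C * k), β, by positivity, hβ, fun v a t b hat htb => ?_⟩
  have hna := norm_nonneg (U a 0 v)
  have hnb := norm_nonneg (U b 0 v)
  have hea := Real.exp_pos (-β * (t - a))
  have heb := Real.exp_pos (-β * (b - t))
  have hsame : ∀ (R : ℝ → E →L[ℝ] E) (I : Set ℝ), IsExpDichotomy U R I k β → a ∈ I → t ∈ I → b ∈ I →
      ‖U t 0 v‖ ≤ (k + k * (C * k)) * (Real.exp (-β * (t - a)) * ‖U a 0 v‖
        + Real.exp (-β * (b - t)) * ‖U b 0 v‖) := by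
    intro R I hR ha ht hb
    have h1 := hR.norm_le hU v ha ht hb hat htb
    have h2 : 0 ≤ k * (C * k) * (Real.exp (-β * (t - a)) * ‖U a 0 v‖
        + Real.exp (-β * (b - t)) * ‖U b 0 v‖) := by positivity
    linarith
  rcases le_or_gt 0 a with ha | ha
  · exact hsame P (Ici 0) hP ha (ha.trans hat) (ha.trans (hat.trans htb))
  rcases le_or_gt b 0 with hb | hb
  · exact hsame Q (Iic 0) hQ ha.le (htb.trans hb) hb
  have h0 := hzero v a b ha.le hb.le
  rcases le_total 0 t with ht | ht
  · have h1 := hP.norm_le hU v self_mem_Ici ht hb.le ht htb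
    have e1 : Real.exp (-β * (t - 0)) * Real.exp (-β * (0 - a)) = Real.exp (-β * (t - a)) := by
      rw [← Real.exp_add]; ring_nf
    -- The detour from `b` through `0` to `t` is at least as long as `b - t`, so it only improves
    -- the weight.
    have e2 : Real.exp (-β * (t - 0)) * Real.exp (-β * (b - 0)) ≤ Real.exp (-β * (b - t)) := by
      rw [← Real.exp_add]; exact Real.exp_le_exp.2 (by nlinarith)
    calc ‖U t 0 v‖ ≤ k * Real.exp (-β * (t - 0)) * (C * k * (Real.exp (-β * (0 - a)) * ‖U a 0 v‖
            + Real.exp (-β * (b - 0)) * ‖U b 0 v‖)) + k * Real.exp (-β * (b - t)) * ‖U b 0 v‖ := by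
          refine h1.trans ?_; gcongr
      _ = k * (C * k) * ((Real.exp (-β * (t - 0)) * Real.exp (-β * (0 - a))) * ‖U a 0 v‖
            + (Real.exp (-β * (t - 0)) * Real.exp (-β * (b - 0))) * ‖U b 0 v‖)
            + k * Real.exp (-β * (b - t)) * ‖U b 0 v‖ := by ring
      _ ≤ k * (C * k) * (Real.exp (-β * (t - a)) * ‖U a 0 v‖ + Real.exp (-β * (b - t)) * ‖U b 0 v‖)
            + k * Real.exp (-β * (b - t)) * ‖U b 0 v‖ := by rw [e1]; gcongr
      _ ≤ _ := by
          have : 0 ≤ k * Real.exp (-β * (t - a)) * ‖U a 0 v‖ := by positivity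
          linarith
  · have h1 := hQ.norm_le hU v ha.le ht self_mem_Iic hat ht
    have e1 : Real.exp (-β * (0 - t)) * Real.exp (-β * (b - 0)) = Real.exp (-β * (b - t)) := by
      rw [← Real.exp_add]; ring_nf
    have e2 : Real.exp (-β * (0 - t)) * Real.exp (-β * (0 - a)) ≤ Real.exp (-β * (t - a)) := by
      rw [← Real.exp_add]; exact Real.exp_le_exp.2 (by nlinarith)
    calc ‖U t 0 v‖ ≤ k * Real.exp (-β * (t - a)) * ‖U a 0 v‖ + k * Real.exp (-β * (0 - t)) *
            (C * k * (Real.exp (-β * (0 - a)) * ‖U a 0 v‖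
              + Real.exp (-β * (b - 0)) * ‖U b 0 v‖)) := by
          refine h1.trans ?_; gcongr
      _ = k * Real.exp (-β * (t - a)) * ‖U a 0 v‖ +
            k * (C * k) * ((Real.exp (-β * (0 - t)) * Real.exp (-β * (0 - a))) * ‖U a 0 v‖
              + (Real.exp (-β * (0 - t)) * Real.exp (-β * (b - 0))) * ‖U b 0 v‖) := by ring
      _ ≤ k * Real.exp (-β * (t - a)) * ‖U a 0 v‖ + k * (C * k) *
            (Real.exp (-β * (t - a)) * ‖U a 0 v‖ + Real.exp (-β * (b - t)) * ‖U b 0 v‖) := by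
          rw [e1]; gcongr
      _ ≤ _ := by
          have : 0 ≤ k * Real.exp (-β * (b - t)) * ‖U b 0 v‖ := by positivity
          linarith

end Evolution

/-! ### From noncriticality and bounded growth to a dichotomy on `[0, ∞)`. -/

section Noncritical

open Filter Topology

variable {E : Type*} [NormedAddCommGroup E] [NormedSpace ℝ E] {U : ℝ → ℝ → E →L[ℝ] E}

/-- The initial values at time `0` of the trajectories bounded on `[0, ∞)`. -/
def boundedSubspace (U : ℝ → ℝ → E →L[ℝ] E) : Submodule ℝ E where
  carrier := {v | ∃ M, ∀ t, 0 ≤ t → ‖U t 0 v‖ ≤ M}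
  add_mem' := by
    rintro v w ⟨M, hM⟩ ⟨N, hN⟩
    refine ⟨M + N, fun t ht => ?_⟩
    rw [map_add]
    exact (norm_add_le _ _).trans (add_le_add (hM t ht) (hN t ht))
  zero_mem' := ⟨0, fun t _ => by simp⟩
  smul_mem' := by
    rintro c v ⟨M, hM⟩
    refine ⟨‖c‖ * M, fun t ht => ?_⟩
    rw [map_smul, norm_smul]
    exact mul_le_mul_of_nonneg_left (hM t ht) (norm_nonneg c)

/-- On the half-line `[0, ∞)`, the norm of a trajectory at time `t ≥ T` is at most `θ` times its
supremum over `[t - T, t + T]`. -/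
structure IsNoncritical (U : ℝ → ℝ → E →L[ℝ] E) (T θ : ℝ) : Prop where
  pos : 0 < T
  theta_pos : 0 < θ
  theta_lt_one : θ < 1
  norm_le : ∀ v t, T ≤ t → ∀ M, (∀ u ∈ Icc (t - T) (t + T), ‖U u 0 v‖ ≤ M) → ‖U t 0 v‖ ≤ θ * M

/-- Every application of noncriticality gains a factor `θ` and moves the admissible times `T`
further from `s`. -/
theorem IsNoncritical.norm_le_pow_mul {T θ : ℝ} (hN : IsNoncritical U T θ) (v : E) {s M : ℝ}
    (hs : 0 ≤ s) (hM : ∀ u, s ≤ u → ‖U u 0 v‖ ≤ M) (n : ℕ) {t : ℝ} (ht : s + n * T ≤ t) :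
    ‖U t 0 v‖ ≤ θ ^ n * M := by
  induction n generalizing t with
  | zero => simpa using hM t (by simpa using ht)
  | succ n ih =>
    push_cast at ht
    have hT := hN.pos
    have hnT : 0 ≤ n * T := by positivity
    rw [pow_succ', mul_assoc]
    exact hN.norm_le v t (by linarith) _ fun u hu => ih (by linarith [hu.1])

/-- Bounded growth handles `[s, s + T]`. Beyond it the norm is at most `θ` times a bound valid on
`[s, ∞)`, so any such bound improves to the maximum of `C * ‖U s 0 v‖` and `θ` times itself;
iterating leaves only the first term. -/
theorem IsNoncritical.norm_le_mul_norm_of_mem_boundedSubspace {T θ C : ℝ}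
    (hN : IsNoncritical U T θ)
    (hC : ∀ v s t, 0 ≤ s → s ≤ t → t ≤ s + T → ‖U t 0 v‖ ≤ C * ‖U s 0 v‖) {v : E}
    (hv : v ∈ boundedSubspace U) {s t : ℝ} (hs : 0 ≤ s) (hst : s ≤ t) :
    ‖U t 0 v‖ ≤ C * ‖U s 0 v‖ := by
  obtain ⟨M, hM⟩ := hv
  have hθ := hN.theta_pos
  have hCs : 0 ≤ C * ‖U s 0 v‖ :=
    (norm_nonneg _).trans (hC v s s hs le_rfl (by linarith [hN.pos]))
  have key : ∀ n : ℕ, ∀ u, s ≤ u → ‖U u 0 v‖ ≤ max (C * ‖U s 0 v‖) (θ ^ n * M) := by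
    intro n
    induction n with
    | zero => exact fun u hu => le_max_of_le_right (by simpa using hM u (hs.trans hu))
    | succ n ih =>
      intro u hu
      rcases le_total u (s + T) with h | h
      · exact le_max_of_le_left (hC v s u hs hu h)
      · refine (hN.norm_le v u (by linarith) _ fun w hw => ih w (by linarith [hw.1])).trans ?_
        rw [mul_max_of_nonneg _ _ hθ.le, pow_succ', mul_assoc]
        exact max_le_max_right _ (by nlinarith [hN.theta_lt_one])
  have hlim : Tendsto (fun n : ℕ => max (C * ‖U s 0 v‖) (θ ^ n * M)) atTop
      (𝓝 (max (C * ‖U s 0 v‖) (0 * M))) :=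
    tendsto_const_nhds.max
      ((tendsto_pow_atTop_nhds_zero_of_lt_one hθ.le hN.theta_lt_one).mul_const M)
  have := ge_of_tendsto' hlim fun n => key n t hst
  rwa [zero_mul, max_eq_left hCs] at this

/-- The factor `θ⁻¹` pays for the incomplete last period. -/
theorem pow_floor_div_le_exp {T θ u : ℝ} (hT : 0 < T) (hθ : 0 < θ) (hθ' : θ < 1) :
    θ ^ ⌊u / T⌋₊ ≤ θ⁻¹ * Real.exp (-(-Real.log θ / T) * u) := by
  have h1 : u / T ≤ ⌊u / T⌋₊ + 1 := (Nat.lt_floor_add_one _).le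
  have hlog : Real.log θ < 0 := Real.log_neg hθ hθ'
  rw [← Real.exp_log (inv_pos.2 hθ), ← Real.exp_add, Real.log_inv,
    ← Real.exp_log (pow_pos hθ _), Real.log_pow]
  refine Real.exp_le_exp.2 ?_
  have : -(-Real.log θ / T) * u = Real.log θ * (u / T) := by field_simp
  rw [this]
  nlinarith

theorem IsNoncritical.norm_le_exp_of_mem_boundedSubspace {T θ C : ℝ} (hN : IsNoncritical U T θ)
    (hC : ∀ v s t, 0 ≤ s → s ≤ t → t ≤ s + T → ‖U t 0 v‖ ≤ C * ‖U s 0 v‖) (hC0 : 0 ≤ C) {v : E}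
    (hv : v ∈ boundedSubspace U) {s t : ℝ} (hs : 0 ≤ s) (hst : s ≤ t) :
    ‖U t 0 v‖ ≤ C * θ⁻¹ * Real.exp (-(-Real.log θ / T) * (t - s)) * ‖U s 0 v‖ := by
  have hT := hN.pos
  have h0 : 0 ≤ (t - s) / T := div_nonneg (by linarith) hT.le
  have h1 : (⌊(t - s) / T⌋₊ : ℝ) * T ≤ t - s := by
    rw [← le_div_iff₀ hT]; exact Nat.floor_le h0
  have h2 := hN.norm_le_pow_mul v hs
    (fun u hu => hN.norm_le_mul_norm_of_mem_boundedSubspace hC hv hs hu) ⌊(t - s) / T⌋₊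
    (t := t) (by linarith)
  have h3 := pow_floor_div_le_exp (u := t - s) hT hN.theta_pos hN.theta_lt_one
  calc _ ≤ _ := h2
    _ ≤ θ⁻¹ * Real.exp (-(-Real.log θ / T) * (t - s)) * (C * ‖U s 0 v‖) := by gcongr
    _ = _ := by ring

/-- The running maximum `m` over `[0, r]` satisfies `m r ≤ θ * m (r + T)` once it exceeds `C * ‖v‖`,
and this inequality can be iterated. -/
theorem IsNoncritical.norm_le_pow_mul_of_lt {T θ C : ℝ} (hN : IsNoncritical U T θ)
    (hU : IsEvolutionFamily U)
    (hC : ∀ v s t, 0 ≤ s → s ≤ t → t ≤ s + T → ‖U t 0 v‖ ≤ C * ‖U s 0 v‖) (hC0 : 0 ≤ C) {v : E}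
    {T₁ u₀ : ℝ} (hu₀ : u₀ ∈ Icc 0 T₁) (hv : C * ‖v‖ < ‖U u₀ 0 v‖) (n : ℕ) {t s : ℝ} (ht : T₁ ≤ t)
    (hts : t + n * T ≤ s) : ‖U t 0 v‖ ≤ θ ^ n * (C * ‖U s 0 v‖) := by
  have hT := hN.pos
  have hθ := hN.theta_pos
  have hθ' := hN.theta_lt_one
  have hT₁ : 0 ≤ T₁ := hu₀.1.trans hu₀.2
  have hex : ∀ r, 0 ≤ r → ∃ p ∈ Icc 0 r, ∀ u ∈ Icc 0 r, ‖U u 0 v‖ ≤ ‖U p 0 v‖ := fun r hr =>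
    isCompact_Icc.exists_isMaxOn ⟨0, left_mem_Icc.2 hr⟩ (hU.continuous_apply 0 v).norm.continuousOn
  choose! p hp hmax using hex
  set m : ℝ → ℝ := fun r => ‖U (p r) 0 v‖ with hm
  have hmono : ∀ r r', 0 ≤ r → r ≤ r' → m r ≤ m r' := fun r r' hr hr' =>
    hmax r' (hr.trans hr') _ ⟨(hp r hr).1, (hp r hr).2.trans hr'⟩
  have hbig : ∀ r, T₁ ≤ r → C * ‖v‖ < m r := fun r hr =>
    hv.trans_le (hmax r (hT₁.trans hr) u₀ ⟨hu₀.1, hu₀.2.trans hr⟩)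
  have hpos : ∀ r, T₁ ≤ r → 0 < m r := fun r hr =>
    lt_of_le_of_lt (by positivity) (hbig r hr)
  have hstep : ∀ r, T₁ ≤ r → m r ≤ θ * m (r + T) := by
    intro r hr
    -- By bounded growth from time `0`, a value above `C * ‖v‖` cannot occur before `T`; so the
    -- maximum point is late enough for noncriticality to apply there.
    have hr0 := hT₁.trans hr
    have hpT : T ≤ p r := by
      by_contra! hlt
      have := hC v 0 (p r) le_rfl (hp r hr0).1 (by linarith)
      rw [hU.apply_self] at this
      exact absurd (hbig r hr) (not_lt.2 this)
    exact hN.norm_le v (p r) hpT _ fun u hu => hmax (r + T) (by linarith) u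
      ⟨by linarith [hu.1], by linarith [hu.2, (hp r hr0).2]⟩
  have hiter : ∀ k : ℕ, ∀ r, T₁ ≤ r → m r ≤ θ ^ k * m (r + k * T) := by
    intro k
    induction k with
    | zero => intro r _; simp
    | succ k ih =>
      intro r hr
      refine (hstep r hr).trans ?_
      rw [pow_succ', mul_assoc]
      refine mul_le_mul_of_nonneg_left ((ih (r + T) (by linarith)).trans_eq ?_) hθ.le
      push_cast
      ring_nf
  have hnT : 0 ≤ n * T := by positivity
  have hs : T₁ ≤ s := by linarith
  -- The maximum over `[0, s + T]` is attained after `s`, since otherwise `m (s + T) ≤ m s ≤ θ * m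
  -- (s + T)`; bounded growth from `s` then bounds it.
  have hlast : m (s + T) ≤ C * ‖U s 0 v‖ := by
    have hs0 : 0 ≤ s + T := by linarith
    refine hC v s (p (s + T)) (hT₁.trans hs) ?_ (hp _ hs0).2
    by_contra! hlt
    have h1 : m (s + T) ≤ m s := hmax s (hT₁.trans hs) _ ⟨(hp _ hs0).1, hlt.le⟩
    have h2 := hstep s hs
    have h3 := hpos (s + T) (by linarith)
    nlinarith
  calc ‖U t 0 v‖ ≤ m t := hmax t (hT₁.trans ht) t (right_mem_Icc.2 (hT₁.trans ht))
    _ ≤ θ ^ n * m (t + n * T) := hiter n t ht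
    _ ≤ θ ^ n * (C * ‖U s 0 v‖) := by
        gcongr
        exact (hmono _ _ (by linarith) (show t + n * T ≤ s + T by linarith)).trans hlast

/-- Each unit vector of `W` has an unbounded trajectory, and exceeding `C` by time `n` is an open
condition. Compactness of the unit sphere of `W` gives one `n`, and homogeneity extends it to all of
`W`. -/
theorem exists_uniform_escape_time [FiniteDimensional ℝ E] {W : Submodule ℝ E}
    (hW : Disjoint (boundedSubspace U) W) (C : ℝ) :
    ∃ T₁ : ℝ, 0 ≤ T₁ ∧ ∀ v ∈ W, v ≠ 0 → ∃ u ∈ Icc 0 T₁, C * ‖v‖ < ‖U u 0 v‖ := by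
  have hK : IsCompact (Metric.sphere (0 : E) 1 ∩ W) :=
    (isCompact_sphere 0 1).inter_right W.closed_of_finiteDimensional
  let O : ℕ → Set E := fun n => ⋃ u ∈ Icc (0 : ℝ) n, {v | C < ‖U u 0 v‖}
  have hO : ∀ n, IsOpen (O n) := fun n => isOpen_biUnion fun u _ =>
    isOpen_lt continuous_const (U u 0).continuous.norm
  have hcover : Metric.sphere (0 : E) 1 ∩ W ⊆ ⋃ n, O n := by
    rintro v ⟨hv1, hvW⟩
    have hvb : v ∉ boundedSubspace U := fun hvb => by
      have : v = 0 := Submodule.disjoint_def.1 hW v hvb hvW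
      simp [this] at hv1
    have hvb' : ¬ ∃ M, ∀ t, 0 ≤ t → ‖U t 0 v‖ ≤ M := hvb
    push Not at hvb'
    obtain ⟨t, ht, htC⟩ := hvb' C
    obtain ⟨n, hn⟩ := exists_nat_ge t
    exact mem_iUnion.2 ⟨n, mem_biUnion (⟨ht, hn⟩ : t ∈ Icc (0 : ℝ) n) htC⟩
  have hdir : Directed (· ⊆ ·) O := Monotone.directed_le fun n k hnk =>
    biUnion_subset_biUnion_left (Icc_subset_Icc_right (Nat.cast_le.2 hnk))
  obtain ⟨n, hn⟩ := hK.elim_directed_cover O hO hcover hdir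
  refine ⟨n, n.cast_nonneg, fun v hvW hv => ?_⟩
  have hv0 : 0 < ‖v‖ := norm_pos_iff.2 hv
  have hmem : (‖v‖⁻¹ • v) ∈ Metric.sphere (0 : E) 1 ∩ W :=
    ⟨by simp [norm_smul, hv0.ne'], W.smul_mem _ hvW⟩
  obtain ⟨u, hu, huC⟩ := mem_iUnion₂.1 (hn hmem)
  refine ⟨u, hu, ?_⟩
  have huC' : C < ‖v‖⁻¹ * ‖U u 0 v‖ := by simpa [norm_smul] using huC
  rwa [← div_eq_inv_mul, lt_div_iff₀ hv0] at huC'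

theorem IsNoncritical.exists_norm_le_exp_of_disjoint [FiniteDimensional ℝ E] {T θ C : ℝ}
    (hN : IsNoncritical U T θ) (hU : IsEvolutionFamily U)
    (hC : ∀ v s t, 0 ≤ s → s ≤ t → t ≤ s + T → ‖U t 0 v‖ ≤ C * ‖U s 0 v‖) (hC1 : 1 ≤ C)
    {W : Submodule ℝ E} (hW : Disjoint (boundedSubspace U) W) :
    ∃ K : ℝ, 1 ≤ K ∧ ∀ v ∈ W, ∀ t s, 0 ≤ t → t ≤ s →
      ‖U t 0 v‖ ≤ K * Real.exp (-(-Real.log θ / T) * (s - t)) * ‖U s 0 v‖ := by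
  have := FiniteDimensional.complete ℝ E
  have hT := hN.pos
  have hθ := hN.theta_pos
  have hlog : Real.log θ < 0 := Real.log_neg hθ hN.theta_lt_one
  set α : ℝ := -Real.log θ / T with hα
  have hα0 : 0 < α := div_pos (by linarith) hT
  obtain ⟨T₁, hT₁, hesc⟩ := exists_uniform_escape_time hW C
  obtain ⟨N, hN1, hNle⟩ := hU.exists_norm_le_Icc 0 T₁
  have hfar : ∀ v ∈ W, ∀ t s, T₁ ≤ t → t ≤ s →
      ‖U t 0 v‖ ≤ C * θ⁻¹ * Real.exp (-α * (s - t)) * ‖U s 0 v‖ := by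
    intro v hv t s ht hts
    rcases eq_or_ne v 0 with rfl | hv0
    · simp
    obtain ⟨u, hu, huC⟩ := hesc v hv hv0
    have h1 : (⌊(s - t) / T⌋₊ : ℝ) * T ≤ s - t := by
      rw [← le_div_iff₀ hT]; exact Nat.floor_le (div_nonneg (by linarith) hT.le)
    have h2 := hN.norm_le_pow_mul_of_lt hU hC (by linarith) hu huC ⌊(s - t) / T⌋₊ ht
      (s := s) (by linarith)
    have h3 := pow_floor_div_le_exp (u := s - t) hT hN.theta_pos hN.theta_lt_one
    calc _ ≤ _ := h2
      _ ≤ θ⁻¹ * Real.exp (-α * (s - t)) * (C * ‖U s 0 v‖) := by gcongr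
      _ = _ := by ring
  have hnear : ∀ v t s, t ∈ Icc 0 T₁ → s ∈ Icc 0 T₁ → ‖U t 0 v‖ ≤ N * ‖U s 0 v‖ := by
    intro v t s ht hs
    rw [← hU.apply_apply t s 0]
    exact (U t s).le_of_opNorm_le (hNle t ht s hs) _
  have hCθ : 1 ≤ C * θ⁻¹ := one_le_mul_of_one_le_of_one_le hC1 ((one_le_inv₀ hθ).2 hN.theta_lt_one.le)
  have hE1 : 1 ≤ Real.exp (α * T₁) := Real.one_le_exp (by positivity)
  have hNE : 1 ≤ N * Real.exp (α * T₁) := one_le_mul_of_one_le_of_one_le hN1 hE1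
  -- Before the escape time only the compactness bound `N` is available; `exp (α * T₁)` makes up for
  -- the decay not obtained on `[0, T₁]`.
  refine ⟨C * θ⁻¹ * (N * Real.exp (α * T₁)), one_le_mul_of_one_le_of_one_le hCθ hNE,
    fun v hv t s ht hts => ?_⟩
  rcases le_total T₁ t with h | h
  · refine (hfar v hv t s h hts).trans ?_
    have hle := le_mul_of_one_le_right (by positivity : 0 ≤ C * θ⁻¹) hNE
    exact mul_le_mul_of_nonneg_right (mul_le_mul_of_nonneg_right hle (Real.exp_nonneg _))
      (norm_nonneg _)
  rcases le_total T₁ s with h' | h'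
  · calc ‖U t 0 v‖ ≤ N * ‖U T₁ 0 v‖ := hnear v t T₁ ⟨ht, h⟩ ⟨hT₁, le_rfl⟩
      _ ≤ N * (C * θ⁻¹ * Real.exp (-α * (s - T₁)) * ‖U s 0 v‖) := by
          gcongr; exact hfar v hv T₁ s le_rfl h'
      _ ≤ N * (C * θ⁻¹ * (Real.exp (α * T₁) * Real.exp (-α * (s - t))) * ‖U s 0 v‖) := by
          gcongr
          rw [← Real.exp_add]
          exact Real.exp_le_exp.2 (by nlinarith)
      _ = _ := by ring
  · calc ‖U t 0 v‖ ≤ N * ‖U s 0 v‖ := hnear v t s ⟨ht, h⟩ ⟨ht.trans hts, h'⟩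
      _ = 1 * (N * 1) * ‖U s 0 v‖ := by ring
      _ ≤ C * θ⁻¹ * (N * (Real.exp (α * T₁) * Real.exp (-α * (s - t)))) * ‖U s 0 v‖ := by
          gcongr
          rw [← Real.exp_add]
          exact Real.one_le_exp (by nlinarith)
      _ = _ := by ring

/-- A uniform gap between decaying and growing trajectories, together with bounded growth, bounds
the components of a trajectory by the trajectory itself. -/
theorem norm_le_of_decay_of_growth {K α H C a b c a' b' c' : ℝ} (hK : 1 ≤ K)
    (hH : K * Real.exp (-α * H) = (2 * K)⁻¹ * 1) (ha : 0 ≤ a) (hb : 0 ≤ b)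
    (ha' : a' ≤ K * Real.exp (-α * H) * a) (hb' : b ≤ K * Real.exp (-α * H) * b')
    (hc : c' ≤ C * c) (habc : b' - a' ≤ c') (hac : a ≤ c + b) :
    b ≤ (C + 1) * c ∧ a ≤ (C + 2) * c := by
  rw [hH, mul_one] at ha' hb'
  have h1 : 2 * K * b ≤ b' := by
    rw [← div_eq_inv_mul, le_div_iff₀ (by positivity)] at hb'
    linarith
  have h2 : a' ≤ a := by
    rw [← div_eq_inv_mul] at ha'
    exact ha'.trans (div_le_self ha (by linarith))
  have h3 : 2 * b ≤ 2 * K * b := by nlinarith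
  -- Now `2 * b - a ≤ b' - a' ≤ C * c`, while `a ≤ c + b`.
  constructor <;> nlinarith

/-- A noncritical evolution family with bounded growth on `[0, ∞)` has an exponential dichotomy
there. -/
theorem IsNoncritical.exists_isExpDichotomy [FiniteDimensional ℝ E] {T θ : ℝ}
    (hN : IsNoncritical U T θ) (hU : IsEvolutionFamily U)
    (hG : ∀ H, 0 < H → ∃ C, 1 ≤ C ∧ ∀ v s t, 0 ≤ s → s ≤ t → t ≤ s + H →
      ‖U t 0 v‖ ≤ C * ‖U s 0 v‖) :
    ∃ P K α, IsExpDichotomy U P (Ici 0) K α := by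
  have hT := hN.pos
  have hθ := hN.theta_pos
  obtain ⟨C, hC1, hC⟩ := hG T hT
  obtain ⟨W, hW⟩ := (boundedSubspace U).exists_isCompl
  obtain ⟨K₂, hK₂, hunst⟩ := hN.exists_norm_le_exp_of_disjoint hU hC hC1 hW.disjoint
  have hstab : ∀ v ∈ boundedSubspace U, ∀ s t, 0 ≤ s → s ≤ t → ‖U t 0 v‖
      ≤ C * θ⁻¹ * Real.exp (-(-Real.log θ / T) * (t - s)) * ‖U s 0 v‖ := fun v hv s t hs hst =>
    hN.norm_le_exp_of_mem_boundedSubspace hC (by linarith) hv hs hst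
  set α : ℝ := -Real.log θ / T with hα
  have hα0 : 0 < α := div_pos (neg_pos.2 (Real.log_neg hθ hN.theta_lt_one)) hT
  obtain ⟨k, hk1, hk2⟩ : ∃ k, C * θ⁻¹ ≤ k ∧ K₂ ≤ k := ⟨max _ _, le_max_left _ _, le_max_right _ _⟩
  have hk : 1 ≤ k := hK₂.trans hk2
  replace hstab : ∀ v ∈ boundedSubspace U, ∀ s t, 0 ≤ s → s ≤ t → ‖U t 0 v‖
      ≤ k * Real.exp (-α * (t - s)) * ‖U s 0 v‖ := fun v hv s t hs hst =>
    (hstab v hv s t hs hst).trans (by gcongr)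
  replace hunst : ∀ v ∈ W, ∀ t s, 0 ≤ t → t ≤ s → ‖U t 0 v‖
      ≤ k * Real.exp (-α * (s - t)) * ‖U s 0 v‖ := fun v hv t s ht hts =>
    (hunst v hv t s ht hts).trans (by gcongr)
  -- The requirement is `exp (α * H) = 2 * k ^ 2`.
  obtain ⟨H, hH0, hH⟩ : ∃ H, 0 < H ∧ k * Real.exp (-α * H) = (2 * k)⁻¹ * 1 := by
    refine ⟨Real.log (2 * k ^ 2) / α, div_pos (Real.log_pos (by nlinarith)) hα0, ?_⟩
    have : -α * (Real.log (2 * k ^ 2) / α) = -Real.log (2 * k ^ 2) := by field_simp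
    rw [this, Real.exp_neg, Real.exp_log (by positivity)]
    field_simp
  obtain ⟨D, hD1, hD⟩ := hG H hH0
  set p : E →L[ℝ] E := LinearMap.toContinuousLinearMap ((boundedSubspace U).projection W hW) with hp
  have hpmem : ∀ v, p v ∈ boundedSubspace U := fun v => Submodule.projection_apply_mem hW v
  have hpp : ∀ v, p (p v) = p v := fun v =>
    Submodule.projection_apply_left hW ⟨p v, hpmem v⟩
  have hqmem : ∀ v, v - p v ∈ W := fun v => by
    have h0 : (boundedSubspace U).projection W hW (v - p v) = 0 := by
      rw [map_sub, sub_eq_zero]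
      exact (hpp v).symm
    rwa [← LinearMap.mem_ker, Submodule.ker_projection] at h0
  -- If the two components nearly cancelled at time `s`, by time `s + H` the unstable one would
  -- dominate and the sum would grow more than `D` permits. This bounds the transported projections
  -- uniformly in `s`.
  have hcomp : ∀ v s, 0 ≤ s → ‖U s 0 (v - p v)‖ ≤ (D + 1) * ‖U s 0 v‖ ∧
      ‖U s 0 (p v)‖ ≤ (D + 2) * ‖U s 0 v‖ := by
    intro v s hs
    have h1 := hstab _ (hpmem v) s (s + H) hs (by linarith)
    have h2 := hunst _ (hqmem v) s (s + H) hs (by linarith)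
    rw [add_sub_cancel_left] at h1 h2
    refine norm_le_of_decay_of_growth hk hH (norm_nonneg _) (norm_nonneg _) h1 h2
      (hD v s (s + H) hs (by linarith) le_rfl) ?_ ?_
    · have := norm_sub_norm_le (U (s + H) 0 (v - p v)) (-(U (s + H) 0 (p v)))
      rwa [norm_neg, sub_neg_eq_add, ← map_add, sub_add_cancel] at this
    · have := norm_sub_le (U s 0 v) (U s 0 (v - p v))
      rwa [← map_sub, sub_sub_cancel] at this
  have hk0 : 0 < k := by linarith
  refine ⟨fun t => ((U t 0).comp p).comp (U 0 t), k * (D + 2), α, ?_, hα0, fun t _ => ?_,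
    fun t _ s _ => ?_, fun t ht s hs hst => ?_, fun t ht s hs hts => ?_⟩
  · exact one_le_mul_of_one_le_of_one_le hk (by linarith)
  · ext v
    simp [hU.apply_apply, hU.apply_self, hpp]
  · ext v
    simp [hU.apply_apply]
  · refine ContinuousLinearMap.opNorm_le_bound _ (by positivity) fun w => ?_
    have h1 := hstab _ (hpmem (U 0 s w)) s t hs hst
    have h2 := (hcomp (U 0 s w) s hs).2
    rw [hU.apply_apply s 0 s, hU.apply_self] at h2
    simp only [ContinuousLinearMap.comp_apply, hU.apply_apply]
    calc _ ≤ _ := h1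
      _ ≤ k * Real.exp (-α * (t - s)) * ((D + 2) * ‖w‖) := by gcongr
      _ = _ := by ring
  · refine ContinuousLinearMap.opNorm_le_bound _ (by positivity) fun w => ?_
    have h1 := hunst _ (hqmem (U 0 s w)) t s ht hts
    have h2 := (hcomp (U 0 s w) s hs).1
    rw [hU.apply_apply s 0 s, hU.apply_self] at h2
    have heq : ((U t s).comp (ContinuousLinearMap.id ℝ E - ((U s 0).comp p).comp (U 0 s))) w
        = U t 0 (U 0 s w - p (U 0 s w)) := by
      simp [hU.apply_apply]
    rw [heq]
    calc _ ≤ _ := h1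
      _ ≤ k * Real.exp (-α * (s - t)) * ((D + 2) * ‖w‖) := by
          gcongr
          exact h2.trans (by gcongr; norm_num)
      _ = _ := by ring

end Noncritical

/-! ### Logarithmic time and translation to evolution families. -/

section LogarithmicTime

variable {a₀ : WithBot ℝ}

namespace GrowthRate

variable (h : GrowthRate a₀)

theorem strictMono : StrictMono fun t : J a₀ => h t := fun _ _ hst => h.strictMono_toHomeomorph hst

theorem le_iff {s t : J a₀} : h s ≤ h t ↔ s ≤ t := h.strictMono.le_iff_le

theorem lt_iff {s t : J a₀} : h s < h t ↔ s < t := h.strictMono.lt_iff_lt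

theorem apply_inv (y : ℝ) (hy : 0 < y) : h (h.inv y hy) = y := by
  simp [inv]

theorem apply_star (t s : J a₀) : h (h.star t s) = h t * h s := h.apply_inv _ _

theorem apply_unit : h h.unit = 1 := h.apply_inv _ _

theorem apply_starInv (t : J a₀) : h (h.starInv t) = 1 / h t := h.apply_inv _ _

/-- The parametrization of `J` by logarithmic time, sending `τ` to `h⁻¹ (exp τ)`. -/
def ofLog (τ : ℝ) : J a₀ := h.inv (Real.exp τ) (Real.exp_pos τ)

theorem apply_ofLog (τ : ℝ) : h (h.ofLog τ) = Real.exp τ := h.apply_inv _ _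

theorem ofLog_log (t : J a₀) : h.ofLog (Real.log (h t)) = t :=
  h.strictMono.injective ((h.apply_ofLog _).trans (Real.exp_log (h.pos t)))

theorem ofLog_zero : h.ofLog 0 = h.unit :=
  h.strictMono.injective (by simp only [apply_ofLog, apply_unit, Real.exp_zero])

theorem ofLog_le_ofLog {τ σ : ℝ} : h.ofLog τ ≤ h.ofLog σ ↔ τ ≤ σ := by
  rw [← h.le_iff, apply_ofLog, apply_ofLog, Real.exp_le_exp]

theorem log_le_log_iff {s t : J a₀} : Real.log (h s) ≤ Real.log (h t) ↔ s ≤ t := by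
  rw [← h.ofLog_le_ofLog, ofLog_log, ofLog_log]

theorem unit_lt_ofLog {τ : ℝ} : h.unit < h.ofLog τ ↔ 0 < τ := by
  rw [← h.lt_iff, apply_ofLog, apply_unit, Real.one_lt_exp_iff]

theorem star_ofLog (τ σ : ℝ) : h.star (h.ofLog τ) (h.ofLog σ) = h.ofLog (τ + σ) :=
  h.strictMono.injective (by simp only [apply_star, apply_ofLog, Real.exp_add])

theorem starInv_ofLog (τ : ℝ) : h.starInv (h.ofLog τ) = h.ofLog (-τ) :=
  h.strictMono.injective (by simp only [apply_starInv, apply_ofLog, Real.exp_neg, one_div])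

theorem starAbs_ofLog (τ : ℝ) : h.starAbs (h.ofLog τ) = h.ofLog |τ| := by
  rw [starAbs, starInv_ofLog]
  split_ifs with hτ <;> rw [← ofLog_zero, ofLog_le_ofLog] at hτ
  · rw [abs_of_nonneg hτ]
  · rw [abs_of_neg (not_le.1 hτ)]

theorem continuous_ofLog : Continuous h.ofLog :=
  h.toHomeomorph.symm.continuous.comp (Real.continuous_exp.subtype_mk _)

theorem rpow_div_ofLog (τ σ α : ℝ) :
    (h (h.ofLog τ) / h (h.ofLog σ)) ^ (-α) = Real.exp (-α * (τ - σ)) := by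
  rw [apply_ofLog, apply_ofLog, ← Real.exp_sub, ← Real.exp_mul, mul_comm]

theorem setOf_starAbs_le {T : ℝ} (x : ℝ → ℝ) (t : ℝ) :
    {r : ℝ | ∃ u : J a₀, h.starAbs (h.star u (h.starInv (h.ofLog t))) ≤ h.ofLog T ∧ r = x u}
      = (fun u => x (h.ofLog u)) '' Icc (t - T) (t + T) := by
  have hiff : ∀ u, h.starAbs (h.star (h.ofLog u) (h.starInv (h.ofLog t))) ≤ h.ofLog T ↔
      u ∈ Icc (t - T) (t + T) := by
    intro u
    rw [starInv_ofLog, star_ofLog, starAbs_ofLog, ofLog_le_ofLog, abs_le, mem_Icc]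
    constructor <;> rintro ⟨h1, h2⟩ <;> constructor <;> linarith
  ext r
  constructor
  · rintro ⟨u, hu, rfl⟩
    rw [← h.ofLog_log u, hiff] at hu
    exact ⟨_, hu, by simp only [ofLog_log]⟩
  · rintro ⟨u, hu, rfl⟩
    exact ⟨h.ofLog u, (hiff u).2 hu, rfl⟩

end GrowthRate

variable {E : Type*} [NormedAddCommGroup E] [NormedSpace ℝ E] {A : J a₀ → E →L[ℝ] E}
  {Φ : ℝ → ℝ → E →L[ℝ] E}

/-- The transition matrix in the logarithmic time `τ = log h(t)`. -/
def logTransition (h : GrowthRate a₀) (Φ : ℝ → ℝ → E →L[ℝ] E) (τ σ : ℝ) : E →L[ℝ] E :=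
  Φ (h.ofLog τ) (h.ofLog σ)

theorem IsSolution.continuous_ofLog {x : ℝ → E} (hx : IsSolution A x) (h : GrowthRate a₀) :
    Continuous fun τ => x (h.ofLog τ) :=
  continuous_iff_continuousAt.2 fun τ =>
    ContinuousAt.comp (f := fun τ => ((h.ofLog τ : J a₀) : ℝ)) (hx (h.ofLog τ)).continuousAt
      (continuous_subtype_val.comp h.continuous_ofLog).continuousAt

/-- Since `h` is only a homeomorphism, differentiability in `τ` may be lost; continuity and the
cocycle identity are what survive. -/
theorem IsTransitionMatrix.isEvolutionFamily (hΦ : IsTransitionMatrix A Φ) (hA : Continuous A)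
    (h : GrowthRate a₀) : IsEvolutionFamily (logTransition h Φ) where
  self τ := (hΦ (h.ofLog τ)).1
  comp _ _ _ := hΦ.comp hA _ _ _
  continuous_left σ := continuous_iff_continuousAt.2 fun τ =>
    ContinuousAt.comp (f := fun τ => ((h.ofLog τ : J a₀) : ℝ))
      (g := fun r => Φ r (h.ofLog σ)) ((hΦ (h.ofLog σ)).2 (h.ofLog τ)).continuousAt
      (continuous_subtype_val.comp h.continuous_ofLog).continuousAt

theorem IsTransitionMatrix.isSolution_unit (hΦ : IsTransitionMatrix A Φ) (h : GrowthRate a₀)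
    (v : E) : ∃ x, IsSolution A x ∧ ∀ τ, x (h.ofLog τ) = logTransition h Φ τ 0 v :=
  ⟨_, hΦ.isSolution (h.ofLog 0) v, fun _ => rfl⟩

theorem IsTransitionMatrix.logTransition_apply_solution (hΦ : IsTransitionMatrix A Φ)
    (hA : Continuous A) (h : GrowthRate a₀) {x : ℝ → E} (hx : IsSolution A x) (t : J a₀) :
    logTransition h Φ (Real.log (h t)) 0 (x (h.ofLog 0)) = x t := by
  rw [logTransition, hΦ.apply_solution hA hx, h.ofLog_log]

theorem UniformDichotomyOn.exists_isExpDichotomy {h : GrowthRate a₀} {I : Set (J a₀)}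
    (hD : UniformDichotomyOn h A I) (hA : Continuous A) (hΦ : IsTransitionMatrix A Φ) :
    ∃ P K α, IsExpDichotomy (logTransition h Φ) P (h.ofLog ⁻¹' I) K α := by
  obtain ⟨Ψ, hΨ, P, K, α, hK, hα, hidem, hcomm, hst, hun⟩ := hD
  have heq : ∀ τ σ, logTransition h Φ τ σ = Ψ (h.ofLog τ) (h.ofLog σ) := fun τ σ =>
    hΦ.unique hA hΨ _ _
  refine ⟨fun τ => P (h.ofLog τ), K, α, hK, hα, fun t ht => hidem _ ht, fun t ht s hs => ?_,
    fun t ht s hs hst' => ?_, fun t ht s hs hts => ?_⟩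
  · rw [heq]; exact hcomm _ ht _ hs
  · rw [heq, ← h.rpow_div_ofLog]; exact hst _ ht _ hs (h.ofLog_le_ofLog.2 hst')
  · rw [heq, ← h.rpow_div_ofLog]; exact hun _ ht _ hs (h.ofLog_le_ofLog.2 hts)

theorem IsExpDichotomy.uniformDichotomyOn {h : GrowthRate a₀} {I : Set (J a₀)} {I' : Set ℝ}
    {P : ℝ → E →L[ℝ] E} {K α : ℝ} (hP : IsExpDichotomy (logTransition h Φ) P I' K α)
    (hΦ : IsTransitionMatrix A Φ) (hI : ∀ t ∈ I, Real.log (h t) ∈ I') :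
    UniformDichotomyOn h A I := by
  have heq : ∀ t s : J a₀, logTransition h Φ (Real.log (h t)) (Real.log (h s)) = Φ t s := fun t s => by
    rw [logTransition, h.ofLog_log, h.ofLog_log]
  have hpow : ∀ t s : J a₀, Real.exp (-α * (Real.log (h t) - Real.log (h s)))
      = (h t / h s) ^ (-α) := fun t s => by
    rw [← h.rpow_div_ofLog, h.ofLog_log, h.ofLog_log]
  refine ⟨Φ, hΦ, fun t => P (Real.log (h t)), K, α, hP.one_le, hP.pos,
    fun t ht => hP.idem _ (hI t ht), fun t ht s hs => ?_, fun t ht s hs hst => ?_,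
    fun t ht s hs hts => ?_⟩
  · rw [← heq]; exact hP.comm _ (hI t ht) _ (hI s hs)
  · rw [← heq, ← hpow]; exact hP.stable _ (hI t ht) _ (hI s hs) (h.log_le_log_iff.2 hst)
  · rw [← heq, ← hpow]; exact hP.unstable _ (hI t ht) _ (hI s hs) (h.log_le_log_iff.2 hts)

/-! ### The implications between the three properties. -/

theorem HalfLineDichotomies.expansiveOn [FiniteDimensional ℝ E] {h : GrowthRate a₀}
    (hD : HalfLineDichotomies h A) (hA : Continuous A) : ExpansiveOn h A univ := by
  obtain ⟨h1, h2, h3⟩ := hD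
  obtain ⟨Φ, hΦ, -⟩ := id h1
  obtain ⟨P, K, α, hP⟩ := h1.exists_isExpDichotomy hA hΦ
  obtain ⟨Q, K', α', hQ⟩ := h2.exists_isExpDichotomy hA hΦ
  have hI1 : h.ofLog ⁻¹' Ici h.unit = Ici 0 := by
    ext τ; rw [mem_preimage, mem_Ici, ← h.ofLog_zero, h.ofLog_le_ofLog, mem_Ici]
  have hI2 : h.ofLog ⁻¹' Iic h.unit = Iic 0 := by
    ext τ; rw [mem_preimage, mem_Iic, ← h.ofLog_zero, h.ofLog_le_ofLog, mem_Iic]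
  rw [hI1] at hP
  rw [hI2] at hQ
  obtain ⟨L, β, hL, hβ, hexp⟩ := expansive_of_halfLine_dichotomies (hΦ.isEvolutionFamily hA h) hP hQ
    (by
      rintro v ⟨M, hM⟩
      obtain ⟨x, hx, hxv⟩ := hΦ.isSolution_unit h v
      have h0 := h3 x hx ⟨M, fun t => by
        rw [← h.ofLog_log t, hxv]; exact hM _⟩ (h.ofLog 0)
      rwa [hxv, (hΦ.isEvolutionFamily hA h).apply_self] at h0)
  refine ⟨L, β, hL, hβ, fun x hx a b _ t ht => ?_⟩
  have h5 := hexp (x (h.ofLog 0)) _ _ _ (h.log_le_log_iff.2 ht.1) (h.log_le_log_iff.2 ht.2)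
  simp only [hΦ.logTransition_apply_solution hA h hx, ← h.rpow_div_ofLog, h.ofLog_log] at h5
  simpa only [h.apply_star, h.apply_starInv, mul_one_div] using h5

theorem ExpansiveOn.uniformNoncriticalOn {h : GrowthRate a₀} (hE : ExpansiveOn h A univ) :
    UniformNoncriticalOn h A univ := by
  obtain ⟨L, β, hL, hβ, hexp⟩ := hE
  obtain ⟨T, hT, hT'⟩ : ∃ T, 0 < T ∧ 2 * L * Real.exp (-β * T) ≤ 1 / 2 := by
    -- The second entry gives `exp (-β * T) ≤ 1 / (4 * L)`; the entry `1` keeps `T` positive when `4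
    -- * L ≤ 1`.
    refine ⟨max 1 (Real.log (4 * L) / β), by positivity, ?_⟩
    have h1 : Real.log (4 * L) ≤ β * max 1 (Real.log (4 * L) / β) := by
      rw [← div_le_iff₀' hβ]; exact le_max_right _ _
    have h2 : Real.exp (-β * max 1 (Real.log (4 * L) / β)) ≤ (4 * L)⁻¹ := by
      rw [← Real.exp_log (by positivity : 0 < (4 * L)⁻¹), Real.log_inv]
      exact Real.exp_le_exp.2 (by linarith)
    calc _ ≤ 2 * L * (4 * L)⁻¹ := by gcongr
      _ = 1 / 2 := by field_simp; norm_num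
  refine ⟨h.ofLog T, h.unit_lt_ofLog.2 hT, 1 / 2, by norm_num, fun x hx t _ => ?_⟩
  obtain ⟨t, rfl⟩ : ∃ τ, h.ofLog τ = t := ⟨_, h.ofLog_log t⟩
  rw [h.setOf_starAbs_le (fun u => ‖x u‖) t]
  set S := sSup ((fun u => ‖x (h.ofLog u)‖) '' Icc (t - T) (t + T)) with hS
  have hle : ∀ u ∈ Icc (t - T) (t + T), ‖x (h.ofLog u)‖ ≤ S := fun u hu =>
    le_csSup (isCompact_Icc.bddAbove_image (hx.continuous_ofLog h).norm.continuousOn)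
      (mem_image_of_mem _ hu)
  have ha := hle (t - T) ⟨le_rfl, by linarith⟩
  have hb := hle (t + T) ⟨by linarith, le_rfl⟩
  have key := hexp x hx (h.ofLog (t - T)) (h.ofLog (t + T)) (subset_univ _) (h.ofLog t)
    ⟨h.ofLog_le_ofLog.2 (by linarith), h.ofLog_le_ofLog.2 (by linarith)⟩
  simp only [h.apply_star, h.apply_starInv, mul_one_div, h.rpow_div_ofLog, sub_sub_cancel,
    add_sub_cancel_left] at key
  have hS0 : 0 ≤ S := (norm_nonneg _).trans ha
  calc _ ≤ _ := key
    _ ≤ L * (Real.exp (-β * T) * S + Real.exp (-β * T) * S) := by gcongr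
    _ = 2 * L * Real.exp (-β * T) * S := by ring
    _ ≤ 1 / 2 * S := by gcongr

/-- An arbitrary upper bound `M` on the window replaces the supremum, which makes the inequality
easy to iterate. -/
theorem UniformNoncriticalOn.exists_log {h : GrowthRate a₀} (hN : UniformNoncriticalOn h A univ) :
    ∃ T θ : ℝ, 0 < T ∧ 0 < θ ∧ θ < 1 ∧ ∀ x, IsSolution A x → ∀ t M : ℝ,
      (∀ u ∈ Icc (t - T) (t + T), ‖x (h.ofLog u)‖ ≤ M) → ‖x (h.ofLog t)‖ ≤ θ * M := by
  obtain ⟨T, hT, θ, ⟨hθ, hθ'⟩, hN⟩ := hN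
  obtain ⟨T, rfl⟩ : ∃ τ, h.ofLog τ = T := ⟨_, h.ofLog_log T⟩
  rw [h.unit_lt_ofLog] at hT
  refine ⟨T, θ, hT, hθ, hθ', fun x hx t M hM => ?_⟩
  have key := hN x hx (h.ofLog t) (subset_univ _)
  rw [h.setOf_starAbs_le (fun u => ‖x u‖) t] at key
  refine key.trans (mul_le_mul_of_nonneg_left (csSup_le ?_ ?_) hθ.le)
  · exact (nonempty_Icc.2 (by linarith)).image _
  · rintro _ ⟨u, hu, rfl⟩
    exact hM u hu

theorem UniformNoncriticalOn.noNontrivialBoundedSolution {h : GrowthRate a₀}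
    (hN : UniformNoncriticalOn h A univ) : NoNontrivialBoundedSolution A := by
  obtain ⟨T, θ, hT, hθ, hθ', hN⟩ := hN.exists_log
  rintro x hx ⟨M, hM⟩ t
  have key : ∀ n : ℕ, ∀ τ, ‖x (h.ofLog τ)‖ ≤ θ ^ n * M := by
    intro n
    induction n with
    | zero => intro τ; simpa using hM _
    | succ n ih =>
      intro τ
      rw [pow_succ', mul_assoc]
      exact hN x hx τ _ fun u _ => ih u
  have hlim := (tendsto_pow_atTop_nhds_zero_of_lt_one hθ.le hθ').mul_const M
  have := ge_of_tendsto' hlim fun n => key n (Real.log (h t))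
  rwa [zero_mul, norm_le_zero_iff, h.ofLog_log] at this

theorem UniformNoncriticalOn.halfLineDichotomies [FiniteDimensional ℝ E] {h : GrowthRate a₀}
    (hN : UniformNoncriticalOn h A univ) (hA : Continuous A)
    (hG : UniformBoundedGrowthOn h A (Ici h.unit)) (hD : UniformBoundedDecayOn h A (Iic h.unit)) :
    HalfLineDichotomies h A := by
  have := FiniteDimensional.complete ℝ E
  obtain ⟨Φ, hΦ⟩ := exists_isTransitionMatrix hA
  have hU := hΦ.isEvolutionFamily hA h
  refine ⟨?_, ?_, hN.noNontrivialBoundedSolution⟩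
  all_goals obtain ⟨T, θ, hT, hθ, hθ', hN⟩ := hN.exists_log
  · have hN' : IsNoncritical (logTransition h Φ) T θ := ⟨hT, hθ, hθ', fun v t _ M hM => by
      obtain ⟨x, hx, hxv⟩ := hΦ.isSolution_unit h v
      simp only [← hxv] at hM ⊢
      exact hN x hx t M hM⟩
    obtain ⟨P, K, α, hP⟩ := hN'.exists_isExpDichotomy hU fun H hH => by
      obtain ⟨C, hC1, hC⟩ := hG (h.ofLog H) (h.unit_lt_ofLog.2 hH)
      refine ⟨C, hC1, fun v s t hs hst htH => ?_⟩
      obtain ⟨x, hx, hxv⟩ := hΦ.isSolution_unit h v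
      rw [← hxv, ← hxv]
      refine hC x hx _ ?_ _ ⟨⟨h.ofLog_le_ofLog.2 hst, ?_⟩, ?_⟩
      · rwa [← h.ofLog_zero, mem_Ici, h.ofLog_le_ofLog]
      · rwa [h.star_ofLog, h.ofLog_le_ofLog]
      · rw [← h.ofLog_zero, mem_Ici, h.ofLog_le_ofLog]; linarith
    refine hP.uniformDichotomyOn hΦ fun t ht => ?_
    rwa [mem_Ici, ← h.ofLog_le_ofLog, h.ofLog_log, h.ofLog_zero]
  -- Noncriticality is symmetric under time reversal, and bounded decay on the left half-line
  -- becomes bounded growth on `[0, ∞)` for the reversed family.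
  · have hN' : IsNoncritical (fun t s => logTransition h Φ (-t) (-s)) T θ :=
      ⟨hT, hθ, hθ', fun v t _ M hM => by
        obtain ⟨x, hx, hxv⟩ := hΦ.isSolution_unit h v
        simp only [neg_zero, ← hxv] at hM ⊢
        refine hN x hx (-t) M fun u hu => ?_
        simpa using hM (-u) ⟨by linarith [hu.2], by linarith [hu.1]⟩⟩
    obtain ⟨P, K, α, hP⟩ := hN'.exists_isExpDichotomy hU.reverse fun H hH => by
      obtain ⟨C, hC1, hC⟩ := hD (h.ofLog H) (h.unit_lt_ofLog.2 hH)
      refine ⟨C, hC1, fun v s t hs hst htH => ?_⟩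
      obtain ⟨x, hx, hxv⟩ := hΦ.isSolution_unit h v
      simp only [neg_zero, ← hxv]
      refine hC x hx _ ?_ _ ⟨⟨?_, h.ofLog_le_ofLog.2 (neg_le_neg hst)⟩, ?_⟩
      · rw [← h.ofLog_zero, mem_Iic, h.ofLog_le_ofLog]; linarith
      · rw [h.starInv_ofLog, h.star_ofLog, h.ofLog_le_ofLog]; linarith
      · rw [← h.ofLog_zero, mem_Iic, h.ofLog_le_ofLog]; linarith
    refine hP.reverse.uniformDichotomyOn hΦ fun t ht => ?_
    rw [mem_neg, mem_Ici, neg_nonneg, ← h.ofLog_le_ofLog, h.ofLog_log, h.ofLog_zero]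
    exact ht

end LogarithmicTime

end HDichotomy
end

theorem theorem3p1 {E : Type*} [NormedAddCommGroup E] [NormedSpace ℝ E] [FiniteDimensional ℝ E]
    (a₀ : WithBot ℝ) (h : HDichotomy.GrowthRate a₀)
    (A : HDichotomy.J a₀ → E →L[ℝ] E) (hA : Continuous A) :
    (HDichotomy.UniformBoundedGrowthOn h A (Set.Ici h.unit) →
      HDichotomy.UniformBoundedDecayOn h A (Set.Iic h.unit) →
      List.TFAE
        [HDichotomy.HalfLineDichotomies h A,
         HDichotomy.ExpansiveOn h A Set.univ,
         HDichotomy.UniformNoncriticalOn h A Set.univ]) ∧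
    (HDichotomy.HalfLineDichotomies h A → HDichotomy.ExpansiveOn h A Set.univ) ∧
    (HDichotomy.ExpansiveOn h A Set.univ → HDichotomy.UniformNoncriticalOn h A Set.univ) := by
  refine ⟨fun hG hD => ?_, fun h1 => h1.expansiveOn hA, fun h2 => h2.uniformNoncriticalOn⟩
  tfae_have 1 → 2 := fun h1 => h1.expansiveOn hA
  tfae_have 2 → 3 := fun h2 => h2.uniformNoncriticalOn
  tfae_have 3 → 1 := fun h3 => h3.halfLineDichotomies hA hG hD
  tfae_finish
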